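/- **Notation.** $B(x,r)\subset\mathbb R^3$ denotes the closed ball, $\mathcal H^2$ the two-dimensional Hausdorff measure on $\mathbb R^3$ (normalised to agree with area on planes), and for $v\in\mathbb S^2$ we put $C^{\pm}(\pi/4,v)=\{y\in\mathbb R^3:\ \pm\, y\cdot v\ge |y|\cos(\pi/4)\}$. A compact connected set $\Sigma\subset\mathbb R^3$ is an *admissible surface* if $\Sigma=\partial U$ for some bounded domain (nonempty connected open set) $U\subset\mathbb R^3$ such that (i) there is a constant $K=K(\Sigma)>0$ with $\infty>\mathcal H^2(\Sigma\cap B(x,r))\ge K^{-1}r^2$ for all $x\in\Sigma$ and all $0<r\le\operatorname{diam}\Sigma$; (ii) there is a dense subset $\Sigma^*\subset\Sigma$ such that for each $x\in\Sigma^*$ there exist $v\in\mathbb S^2$ and $\delta_0>0$ with $$B(x,\delta_0)\cap\bigl(x+C^+(\pi/4,v)\bigr)\subset U\cup\{x\},\qquad B(x,\delta_0)\cap\bigl(x+C^-(\pi/4,v)\bigr)\subset(\mathbb R^3\setminus\overline U)\cup\{x\}.$$ For a quadruple $T$ of points of $\mathbb R^3$ let $\mathcal K(T)=\dfrac{V(T)}{A(T)(\operatorname{diam}T)^2}$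 if the points are not coplanar and $\mathcal K(T)=0$ otherwise, where $V(T)$ is the volume of the tetrahedron with these vertices and $A(T)$ is the sum of the areas of its four faces. For $p>0$ let $$\mathscr M_p(\Sigma)=\int_\Sigma\int_\Sigma\int_\Sigma\int_\Sigma \mathcal K(\xi,x,y,z)^p\,d\mathcal H^2(\xi)\,d\mathcal H^2(x)\,d\mathcal H^2(y)\,d\mathcal H^2(z)\in[0,\infty].$$ **Theorem 3.1.** There is an absolute constant $\alpha>0$ such that for every $p>8$, every $E>0$ and every admissible surface $\Sigma$ with $\mathscr M_p(\Sigma)\le E$, setting $R_0(E,p)=\bigl(\alpha^{5p}/E\bigr)^{1/(p-8)}$, one has $$\operatorname{diam}\Sigma\ge R_0(E,p)$$ and $$\mathcal H^2(\Sigma\cap B(x,R))\ge\frac{\pi R^2}{2}\qquad\text{for all }x\in\Sigma\text{ and all }0<R\le R_0(E,p).$$ -/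

import Mathlib

open MeasureTheory Metric
open scoped RealInnerProductSpace

noncomputable section

namespace MengerSurface

/-- Euclidean three-space. -/
abbrev E3 : Type := EuclideanSpace ℝ (Fin 3)

/-- The two-dimensional Hausdorff measure on `ℝ³`, normalised so that it agrees with Lebesgue
measure on planes (a flat disk of radius `r` has measure `π r²`). -/
abbrev H2 : Measure E3 := Measure.euclideanHausdorffMeasure 2

/-- The one-sided closed cone `C⁺(φ, w) = {y : y · w ≥ |y| cos φ}`. -/
def conePos (φ : ℝ) (w : E3) : Set E3 := {y | ‖y‖ * Real.cos φ ≤ ⟪y, w⟫}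

/-- The opposite closed cone `C⁻(φ, w) = {y : -(y · w) ≥ |y| cos φ}`. -/
def coneNeg (φ : ℝ) (w : E3) : Set E3 := {y | ‖y‖ * Real.cos φ ≤ -⟪y, w⟫}

/-- Admissible surfaces: compact connected boundaries of bounded domains (nonempty, connected,
open sets) of `ℝ³` with a lower Ahlfors bound (whose constant may depend on the surface) and, at
a dense set of points, a double cone whose two halves lie on different sides of the surface. -/
def Admissible (S : Set E3) : Prop :=
  IsCompact S ∧ IsConnected S ∧
  ∃ U : Set E3, IsOpen U ∧ IsConnected U ∧ Bornology.IsBounded U ∧ S = frontier U ∧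
    (∃ K : ℝ, 0 < K ∧ ∀ x ∈ S, ∀ r : ℝ, 0 < r → r ≤ diam S →
      H2 (S ∩ closedBall x r) < ⊤ ∧ ENNReal.ofReal (K⁻¹ * r ^ 2) ≤ H2 (S ∩ closedBall x r)) ∧
    ∃ D : Set E3, D ⊆ S ∧ S ⊆ closure D ∧
      ∀ x ∈ D, ∃ v : E3, ‖v‖ = 1 ∧ ∃ δ : ℝ, 0 < δ ∧
        (∀ y ∈ closedBall x δ, y - x ∈ conePos (Real.pi / 4) v → y ∈ U ∪ {x}) ∧
        (∀ y ∈ closedBall x δ, y - x ∈ coneNeg (Real.pi / 4) v → y ∈ (closure U)ᶜ ∪ {x})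

/-- Area of the triangle `abc`: half the area of the parallelogram spanned by `b - a`, `c - a`,
the latter being the square root of the Gram determinant. -/
def triangleArea (a b c : E3) : ℝ :=
  Real.sqrt (‖b - a‖ ^ 2 * ‖c - a‖ ^ 2 - ⟪b - a, c - a⟫ ^ 2) / 2

/-- Volume of the tetrahedron `abcd`: one sixth of the absolute value of the triple product of
the edge vectors at `a`. -/
def tetraVolume (a b c d : E3) : ℝ :=
  |Matrix.det !![(b - a) 0, (b - a) 1, (b - a) 2;
                 (c - a) 0, (c - a) 1, (c - a) 2;
                 (d - a) 0, (d - a) 1, (d - a) 2]| / 6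

/-- Total area of the tetrahedron `abcd`: the sum of the areas of its four faces. -/
def tetraArea (a b c d : E3) : ℝ :=
  triangleArea a b c + triangleArea a b d + triangleArea a c d + triangleArea b c d

open Classical in
/-- The discrete curvature `𝒦(T) = V(T) / (A(T) (diam T)²)` of a tetrahedron with non-coplanar
vertices, and `0` if the vertices are coplanar. -/
def curvK (a b c d : E3) : ℝ :=
  if Coplanar ℝ ({a, b, c, d} : Set E3) then 0
  else tetraVolume a b c d / (tetraArea a b c d * diam ({a, b, c, d} : Set E3) ^ 2)

/-- The integral Menger curvature `ℳ_p(Σ)`, with values in `[0, ∞]`. -/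
def mengerEnergy (p : ℝ) (S : Set E3) : ENNReal :=
  ∫⁻ a in S, ∫⁻ b in S, ∫⁻ c in S, ∫⁻ d in S,
    ENNReal.ofReal (curvK a b c d ^ p) ∂H2 ∂H2 ∂H2 ∂H2

/-- The radius `R₀(E, p) = (α^{5p} / E)^{1/(p-8)}`. -/
def radius0 (α E p : ℝ) : ℝ := (α ^ (5 * p) / E) ^ (1 / (p - 8))

end MengerSurface

end

noncomputable section

namespace MengerSurface

/-! If the sphere of radius `r` about `x` is split, every line parallel to the axis at distance at
most `r / √2` from it runs from `U` to the exterior and meets the surface inside the ball.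
Projecting along the axis then covers a disc of area `π r² / 2` (`SphereSplit.le_H2`).

Small spheres about points of the dense set are split by the cone condition. Where splitting stops,
at a scale comparable to `s`, the surface cannot stay in a thin slab around a plane, for its two
complementary sides would split the next spheres too. So there is a tetrahedron of size at most a
multiple of `s` and volume of order `s³` with vertices on the surface (`exists_fat_tetrahedron`).
Small balls about its vertices give energy at least `c ^ p κ ^ 4 s ^ (8 - p)`, where `κ s²` bounds
their areas from below; as `p > 8`, this bounds `s` from below.

The estimate is used twice: with the Ahlfors constant of the surface, to see that all centres share
a positive splitting radius, then at the supremum of such radii, where splitting itself provides an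
absolute `κ`. -/

/-- The two opposite caps of opening angle `π / 4` of the sphere of radius `r` around `x` lie on
different sides of the boundary of `U`. -/
def SphereSplit (U : Set E3) (x : E3) (r : ℝ) : Prop :=
  ∃ v : E3, ‖v‖ = 1 ∧ ∀ y : E3, ‖y‖ = r →
    (y ∈ conePos (Real.pi / 4) v → x + y ∈ U) ∧
    (y ∈ coneNeg (Real.pi / 4) v → x + y ∈ (closure U)ᶜ)

/-! ### Cones, separation by the frontier, and the area bound from splitting -/

lemma mem_conePos_pi_div_four {y v : E3} (h0 : 0 ≤ ⟪y, v⟫) (h : ‖y‖ ^ 2 ≤ 2 * ⟪y, v⟫ ^ 2) :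
    y ∈ conePos (Real.pi / 4) v := by
  simp only [conePos, Set.mem_ofPred_eq, Real.cos_pi_div_four]
  have h2 : Real.sqrt 2 ^ 2 = 2 := Real.sq_sqrt (by norm_num)
  apply le_of_sq_le_sq _ h0
  nlinarith

lemma mem_coneNeg_pi_div_four {y v : E3} (h0 : ⟪y, v⟫ ≤ 0) (h : ‖y‖ ^ 2 ≤ 2 * ⟪y, v⟫ ^ 2) :
    y ∈ coneNeg (Real.pi / 4) v := by
  simp only [coneNeg, Set.mem_ofPred_eq, Real.cos_pi_div_four]
  have h2 : Real.sqrt 2 ^ 2 = 2 := Real.sq_sqrt (by norm_num)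
  apply le_of_sq_le_sq _ (by linarith)
  nlinarith

lemma sq_le_of_mem_conePos {y v : E3} (h : y ∈ conePos (Real.pi / 4) v) :
    0 ≤ ⟪y, v⟫ ∧ ‖y‖ ^ 2 ≤ 2 * ⟪y, v⟫ ^ 2 := by
  simp only [conePos, Set.mem_ofPred_eq, Real.cos_pi_div_four] at h
  have h2 : Real.sqrt 2 ^ 2 = 2 := Real.sq_sqrt (by norm_num)
  have h0 : 0 ≤ ‖y‖ * (√2 / 2) := by positivity
  refine ⟨h0.trans h, ?_⟩
  nlinarith

lemma mem_coneNeg_iff {φ : ℝ} {y v : E3} : y ∈ coneNeg φ v ↔ -y ∈ conePos φ v := by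
  simp [coneNeg, conePos]

/-- A preconnected set which misses the frontier of an open set `U` and meets `U` lies in `U`. -/
lemma subset_of_disjoint_frontier {U A : Set E3} (hU : IsOpen U) (hA : IsPreconnected A)
    (hd : Disjoint A (frontier U)) (hne : (A ∩ U).Nonempty) : A ⊆ U := by
  refine hA.subset_left_of_subset_union hU isClosed_closure.isOpen_compl
    (Set.disjoint_compl_right_iff_subset.2 subset_closure) (fun y hy => ?_) hne
  by_contra h
  simp only [Set.mem_union, Set.mem_compl_iff, not_or, not_not] at h
  exact Set.disjoint_left.1 hd hy (by rw [hU.frontier_eq]; exact ⟨h.2, h.1⟩)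

lemma subset_compl_closure_of_disjoint_frontier {U A : Set E3} (hU : IsOpen U)
    (hA : IsPreconnected A) (hd : Disjoint A (frontier U)) (hne : (A ∩ (closure U)ᶜ).Nonempty) :
    A ⊆ (closure U)ᶜ := by
  refine hA.subset_right_of_subset_union hU isClosed_closure.isOpen_compl
    (Set.disjoint_compl_right_iff_subset.2 subset_closure) (fun y hy => ?_) hne
  by_contra h
  simp only [Set.mem_union, Set.mem_compl_iff, not_or, not_not] at h
  exact Set.disjoint_left.1 hd hy (by rw [hU.frontier_eq]; exact ⟨h.2, h.1⟩)

lemma exists_orthonormalBasis_two_eq {v : E3} (hv : ‖v‖ = 1) :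
    ∃ b : OrthonormalBasis (Fin 3) ℝ E3, b 2 = v := by
  obtain ⟨b, hb⟩ := Orthonormal.exists_orthonormalBasis_extension_of_card_eq (𝕜 := ℝ) (E := E3)
    (ι := Fin 3) (by simp) (v := fun _ => v) (s := {2}) (by
      refine ⟨fun i => by simp [hv], fun i j hij => absurd (Subsingleton.elim i j) hij⟩)
  exact ⟨b, hb 2 rfl⟩

section Basis

variable (b : OrthonormalBasis (Fin 3) ℝ E3)

/-- The vector with given coordinates in an orthonormal basis. -/
def ofCoord (c₀ c₁ c₂ : ℝ) : E3 := c₀ • b 0 + c₁ • b 1 + c₂ • b 2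

lemma inner_ofCoord (c₀ c₁ c₂ d₀ d₁ d₂ : ℝ) :
    ⟪ofCoord b c₀ c₁ c₂, ofCoord b d₀ d₁ d₂⟫ = c₀ * d₀ + c₁ * d₁ + c₂ * d₂ := by
  simp [ofCoord, inner_add_left, inner_add_right, inner_smul_left, inner_smul_right]
  ring

lemma norm_sq_ofCoord (c₀ c₁ c₂ : ℝ) :
    ‖ofCoord b c₀ c₁ c₂‖ ^ 2 = c₀ ^ 2 + c₁ ^ 2 + c₂ ^ 2 := by
  rw [← real_inner_self_eq_norm_sq, inner_ofCoord]; ring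

lemma exists_ofCoord (y : E3) : ∃ c₀ c₁ c₂, y = ofCoord b c₀ c₁ c₂ :=
  ⟨⟪b 0, y⟫, ⟪b 1, y⟫, ⟪b 2, y⟫, by
    conv_lhs => rw [← b.sum_repr' y]
    simp [Fin.sum_univ_three, ofCoord]⟩

lemma ofCoord_zero_zero_one : ofCoord b 0 0 1 = b 2 := by simp [ofCoord]

/-- Every line parallel to the axis of the caps and close enough to it meets the frontier. -/
lemma exists_mem_frontier_of_split {U : Set E3} (hU : IsOpen U) {x : E3} {r : ℝ} (hr : 0 < r)
    (h : ∀ y : E3, ‖y‖ = r →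
      (y ∈ conePos (Real.pi / 4) (b 2) → x + y ∈ U) ∧
      (y ∈ coneNeg (Real.pi / 4) (b 2) → x + y ∈ (closure U)ᶜ))
    (c₀ c₁ : ℝ) (hc : c₀ ^ 2 + c₁ ^ 2 ≤ r ^ 2 / 2) :
    ∃ t : ℝ, c₀ ^ 2 + c₁ ^ 2 + t ^ 2 ≤ r ^ 2 ∧ x + ofCoord b c₀ c₁ t ∈ frontier U := by
  -- Half the chord cut from the ball; `m² ≥ r² / 2` puts both its ends in the caps.
  set m := Real.sqrt (r ^ 2 - c₀ ^ 2 - c₁ ^ 2) with hm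
  have hm2 : m ^ 2 = r ^ 2 - c₀ ^ 2 - c₁ ^ 2 := Real.sq_sqrt (by nlinarith)
  have hm0 : 0 ≤ m := Real.sqrt_nonneg _
  let f : ℝ → E3 := fun t => x + ofCoord b c₀ c₁ t
  have hf : Continuous f := by unfold f ofCoord; fun_prop
  have hn : ∀ t, t ^ 2 = m ^ 2 → ‖ofCoord b c₀ c₁ t‖ = r := by
    intro t ht
    rw [← sq_eq_sq₀ (norm_nonneg _) hr.le, norm_sq_ofCoord]; linarith
  have hi : ∀ t, ⟪ofCoord b c₀ c₁ t, b 2⟫ = t := by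
    intro t; rw [← ofCoord_zero_zero_one, inner_ofCoord]; ring
  have h1 : f m ∈ U := (h _ (hn m rfl)).1 (mem_conePos_pi_div_four (by rw [hi]; exact hm0)
    (by rw [hi, hn m rfl]; nlinarith))
  have h2 : f (-m) ∈ (closure U)ᶜ := (h _ (hn (-m) (by ring))).2
    (mem_coneNeg_pi_div_four (by rw [hi]; linarith)
    (by rw [hi, hn (-m) (by ring)]; nlinarith))
  by_contra! hcon
  have hsub : f '' Set.Icc (-m) m ⊆ U := by
    refine subset_of_disjoint_frontier hU (isPreconnected_Icc.image _ hf.continuousOn) ?_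
      ⟨f m, ⟨m, ⟨by linarith, le_rfl⟩, rfl⟩, h1⟩
    rw [Set.disjoint_left]
    rintro _ ⟨t, ht, rfl⟩
    refine hcon t ?_
    have : t ^ 2 ≤ m ^ 2 := sq_le_sq' ht.1 ht.2
    linarith
  exact h2 (subset_closure (hsub ⟨-m, ⟨le_rfl, by linarith⟩, rfl⟩))

end Basis

/-- A split sphere of radius `r` forces the surface to have area at least `π r² / 2` inside. -/
lemma SphereSplit.le_H2 {U : Set E3} (hU : IsOpen U) {x : E3} {r : ℝ} (hr : 0 < r)
    (h : SphereSplit U x r) :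
    ENNReal.ofReal (Real.pi * r ^ 2 / 2) ≤ H2 (frontier U ∩ closedBall x r) := by
  obtain ⟨v, hv, h⟩ := h
  obtain ⟨b, rfl⟩ := exists_orthonormalBasis_two_eq hv
  -- Orthogonal projection along the axis of the caps.
  let f : E3 → EuclideanSpace ℝ (Fin 2) := fun y => !₂[⟪b 0, y - x⟫, ⟪b 1, y - x⟫]
  have hf : LipschitzWith 1 f := by
    refine LipschitzWith.of_dist_le_mul fun y z => ?_
    rw [NNReal.coe_one, one_mul, dist_eq_norm, dist_eq_norm]
    refine le_of_sq_le_sq ?_ (norm_nonneg _)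
    obtain ⟨c₀, c₁, c₂, hc⟩ := exists_ofCoord b (y - z)
    have h0 : ∀ i, (f y - f z) i = ⟪b i.castSucc, y - z⟫ := by
      intro i
      fin_cases i <;> simp [f, ← inner_sub_right]
    rw [EuclideanSpace.norm_sq_eq, Fin.sum_univ_two, h0, h0, hc, norm_sq_ofCoord]
    simp [ofCoord, inner_add_right, inner_smul_right]
    positivity
  have hsub : closedBall (0 : EuclideanSpace ℝ (Fin 2)) (r / √2) ⊆
      f '' (frontier U ∩ closedBall x r) := by
    intro q hq
    have hq' : q 0 ^ 2 + q 1 ^ 2 ≤ r ^ 2 / 2 := by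
      rw [mem_closedBall_zero_iff] at hq
      have := pow_le_pow_left₀ (norm_nonneg _) hq 2
      rw [EuclideanSpace.norm_sq_eq, Fin.sum_univ_two, div_pow, Real.sq_sqrt (by norm_num)] at this
      simpa using this
    obtain ⟨t, ht, hmem⟩ := exists_mem_frontier_of_split b hU hr h _ _ hq'
    refine ⟨_, ⟨hmem, ?_⟩, ?_⟩
    · rw [mem_closedBall, dist_eq_norm, add_sub_cancel_left]
      refine le_of_sq_le_sq ?_ hr.le
      rwa [norm_sq_ofCoord]
    · ext i
      fin_cases i <;>
        simp [f, ofCoord, inner_add_right, inner_smul_right]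
  have hvol : H2 (frontier U ∩ closedBall x r) ≥
      (volume : Measure (EuclideanSpace ℝ (Fin 2))) (f '' (frontier U ∩ closedBall x r)) := by
    rw [← EuclideanSpace.euclideanHausdorffMeasure_eq_volume]
    simp only [H2, Measure.euclideanHausdorffMeasure_def, Measure.smul_apply]
    gcongr
    simpa using hf.hausdorffMeasure_image_le (d := 2) (by norm_num) (frontier U ∩ closedBall x r)
  refine le_trans ?_ ((measure_mono hsub).trans hvol)
  rw [EuclideanSpace.volume_closedBall_fin_two, ← ENNReal.ofReal_pow (by positivity)]
  have : ENNReal.ofReal (Real.pi * r ^ 2 / 2) =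
      ENNReal.ofReal ((r / √2) ^ 2) * ENNReal.ofReal Real.pi := by
    rw [← ENNReal.ofReal_mul (by positivity), div_pow, Real.sq_sqrt (by norm_num)]
    congr 1; ring
  rw [this]

/-! ### Triple products and fat tetrahedra where splitting stops -/

/-- The triple product of three vectors. -/
def tripleDet (u v w : E3) : ℝ :=
  Matrix.det !![u 0, u 1, u 2; v 0, v 1, v 2; w 0, w 1, w 2]

lemma tripleDet_eq (u v w : E3) : tripleDet u v w =
    u 0 * v 1 * w 2 - u 0 * v 2 * w 1 - u 1 * v 0 * w 2 + u 1 * v 2 * w 0 + u 2 * v 0 * w 1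
      - u 2 * v 1 * w 0 := by
  simp [tripleDet, Matrix.det_fin_three]

section Basis

variable (b : OrthonormalBasis (Fin 3) ℝ E3)

lemma abs_tripleDet_basis : |tripleDet (b 0) (b 1) (b 2)| = 1 := by
  set B : Matrix (Fin 3) (Fin 3) ℝ := Matrix.of fun i j => b i j with hB
  have hdet : tripleDet (b 0) (b 1) (b 2) = B.det := by
    rw [tripleDet]; congr 1; ext i j; fin_cases i <;> fin_cases j <;> rfl
  have hmul : B * B.transpose = 1 := by
    ext i j
    have := orthonormal_iff_ite.1 b.orthonormal i j
    rw [PiLp.inner_apply] at this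
    rw [Matrix.mul_apply, Matrix.one_apply, ← this]
    refine Finset.sum_congr rfl fun k _ => ?_
    simp [hB, mul_comm]
  have h2 : B.det ^ 2 = 1 := by
    rw [sq]; nth_rewrite 2 [← Matrix.det_transpose]; rw [← Matrix.det_mul, hmul, Matrix.det_one]
  rw [hdet, ← sq_eq_sq₀ (abs_nonneg _) zero_le_one, sq_abs, h2, one_pow]

lemma abs_tripleDet_ofCoord (c₀ c₁ c₂ d₀ d₁ d₂ e₀ e₁ e₂ : ℝ) :
    |tripleDet (ofCoord b c₀ c₁ c₂) (ofCoord b d₀ d₁ d₂) (ofCoord b e₀ e₁ e₂)| =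
      |c₀ * d₁ * e₂ - c₀ * d₂ * e₁ - c₁ * d₀ * e₂ + c₁ * d₂ * e₀ + c₂ * d₀ * e₁
        - c₂ * d₁ * e₀| := by
  rw [← mul_one |c₀ * d₁ * e₂ - _ - _ + _ + _ - _|, ← abs_tripleDet_basis b, ← abs_mul]
  congr 1
  simp only [tripleDet_eq, ofCoord, PiLp.add_apply, PiLp.smul_apply, smul_eq_mul]
  ring

end Basis

/-- If the sphere of radius `s` is split but some sphere of radius `t ∈ [s, 2 s]` is not, then the
surface contains a fat tetrahedron of size comparable to `s`. -/
lemma exists_tripleDet_gt {U : Set E3} (hU : IsOpen U) {x : E3} {s t : ℝ} (hs : 0 < s)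
    (h : SphereSplit U x s) (hst : s ≤ t) (hts : t ≤ 2 * s) (ht : ¬ SphereSplit U x t) :
    ∃ u v w : E3, x + u ∈ frontier U ∧ x + v ∈ frontier U ∧ x + w ∈ frontier U ∧
      ‖u‖ ≤ 2 * s ∧ ‖v‖ ≤ 2 * s ∧ ‖w‖ ≤ 2 * s ∧ s ^ 2 / 2 ≤ ‖u‖ ^ 2 ∧
      s ^ 3 / 4 < |tripleDet u v w| := by
  obtain ⟨v, hv, h⟩ := h
  obtain ⟨b, rfl⟩ := exists_orthonormalBasis_two_eq hv
  -- The largest offset from the axis at which lines are known to meet the surface.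
  obtain ⟨a, ha0, ha⟩ : ∃ a : ℝ, 0 < a ∧ a ^ 2 = s ^ 2 / 2 :=
    ⟨s / √2, by positivity, by rw [div_pow, Real.sq_sqrt (by norm_num)]⟩
  obtain ⟨t₁, ht₁, hm₁⟩ := exists_mem_frontier_of_split b hU hs h a 0 (by nlinarith)
  obtain ⟨t₂, ht₂, hm₂⟩ := exists_mem_frontier_of_split b hU hs h 0 a (by nlinarith)
  -- Normal to the plane through `x` and the two points found, scaled to have component 1 along the
  -- old axis.
  set N := ofCoord b (-(t₁ / a)) (-(t₂ / a)) 1 with hN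
  have hdet : ∀ w, |tripleDet (ofCoord b a 0 t₁) (ofCoord b 0 a t₂) w| =
      s ^ 2 / 2 * |⟪w, N⟫| := by
    intro w
    obtain ⟨c₀, c₁, c₂, rfl⟩ := exists_ofCoord b w
    rw [abs_tripleDet_ofCoord, hN, inner_ofCoord, ← ha, ← abs_of_pos (pow_pos ha0 2), ← abs_mul]
    congr 1
    field_simp
    ring
  have hbound : ∀ {c₀ c₁ c₂}, c₀ ^ 2 + c₁ ^ 2 + c₂ ^ 2 ≤ s ^ 2 →
      ‖ofCoord b c₀ c₁ c₂‖ ≤ 2 * s := by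
    intro c₀ c₁ c₂ hc
    refine le_of_sq_le_sq ?_ (by positivity)
    rw [norm_sq_ofCoord]; nlinarith
  by_contra! hcon
  have hslab : ∀ w, x + w ∈ frontier U → ‖w‖ ≤ 2 * s → |⟪w, N⟫| ≤ s / 2 := by
    intro w hw hw2
    have := hcon _ _ w hm₁ hm₂ hw (hbound ht₁) (hbound ht₂) hw2
      (by rw [norm_sq_ofCoord]; nlinarith)
    rw [hdet] at this
    have h2 : s ^ 2 / 2 * |⟪w, N⟫| ≤ s ^ 2 / 2 * (s / 2) := by linarith
    exact le_of_mul_le_mul_left h2 (by positivity)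
  have hb2 : ⟪b 2, N⟫ = (1 : ℝ) := by
    rw [← ofCoord_zero_zero_one, hN, inner_ofCoord]; ring
  have hN1 : 1 ≤ ‖N‖ ^ 2 := by
    rw [hN, norm_sq_ofCoord]; nlinarith [sq_nonneg (-(t₁ / a)), sq_nonneg (-(t₂ / a))]
  have hN1' : 1 ≤ ‖N‖ := by
    by_contra! h'
    nlinarith [norm_nonneg N]
  have hsb : ‖s • b 2‖ = s := by rw [norm_smul, hv, mul_one, Real.norm_of_nonneg hs.le]
  have hsi : ⟪s • b 2, b 2⟫ = s := by
    rw [real_inner_smul_left, real_inner_self_eq_norm_sq, hv]; ring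
  have hside : ∀ σ : ℝ, IsPreconnected
      (closedBall x (2 * s) ∩ {y | s / 2 < ⟪y - x, σ • N⟫}) := by
    intro σ
    refine ((convex_closedBall x _).inter ?_).isPreconnected
    have : {y : E3 | s / 2 < ⟪y - x, σ • N⟫} =
        {y : E3 | s / 2 + ⟪x, σ • N⟫ < innerSL ℝ (σ • N) y} := by
      ext y
      simp only [Set.mem_ofPred_eq, inner_sub_left, innerSL_apply_apply,
        real_inner_comm y (σ • N)]
      constructor <;> intro h <;> linarith
    rw [this]
    exact convex_halfSpace_gt (innerSL ℝ (σ • N)).toLinearMap.isLinear _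
  have hdisj : ∀ σ : ℝ, |σ| = 1 → Disjoint
      (closedBall x (2 * s) ∩ {y | s / 2 < ⟪y - x, σ • N⟫}) (frontier U) := by
    intro σ hσ
    rw [Set.disjoint_left]
    rintro y ⟨hy, hy2⟩ hyU
    have := hslab (y - x) (by simpa using hyU) (by simpa [dist_eq_norm] using hy)
    rw [Set.mem_ofPred_eq, real_inner_smul_right] at hy2
    have h3 := le_abs_self (σ * ⟪y - x, N⟫)
    rw [abs_mul, hσ, one_mul] at h3
    linarith
  -- Each side of the slab contains the centre of an old cap, which decides whether it lies in `U`
  -- or in the exterior.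
  have hpos := subset_of_disjoint_frontier hU (hside 1) (hdisj 1 (by simp)) ⟨x + s • b 2, ⟨by
      rw [mem_closedBall, dist_eq_norm, add_sub_cancel_left, hsb]; linarith, by
      rw [Set.mem_ofPred_eq, add_sub_cancel_left, one_smul, real_inner_smul_left, hb2]; linarith⟩,
      (h _ hsb).1 (mem_conePos_pi_div_four (by rw [hsi]; exact hs.le)
        (by rw [hsi, hsb]; nlinarith))⟩
  have hneg := subset_compl_closure_of_disjoint_frontier hU (hside (-1)) (hdisj (-1) (by simp))
    ⟨x + -(s • b 2), ⟨by
      rw [mem_closedBall, dist_eq_norm, add_sub_cancel_left, norm_neg, hsb]; linarith, by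
      rw [Set.mem_ofPred_eq, add_sub_cancel_left, neg_one_smul, inner_neg_neg,
        real_inner_smul_left, hb2]; linarith⟩,
      (h _ (by rw [norm_neg, hsb])).2 (mem_coneNeg_iff.2 (by
        rw [neg_neg]
        exact mem_conePos_pi_div_four (by rw [hsi]; exact hs.le) (by rw [hsi, hsb]; nlinarith)))⟩
  -- On the new caps `⟪y, N⟫ ≥ t ‖N‖ / √2 ≥ s / √2`, so they avoid the slab.
  have hcap : ∀ y : E3, ‖y‖ = t → y ∈ conePos (Real.pi / 4) (‖N‖⁻¹ • N) → s / 2 < ⟪y, N⟫ := by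
    intro y hy hyc
    obtain ⟨h0, h1⟩ := sq_le_of_mem_conePos hyc
    rw [real_inner_smul_right, inv_mul_eq_div] at h0 h1
    have h2 : 0 ≤ ⟪y, N⟫ := by
      have := mul_nonneg h0 (norm_nonneg N)
      rwa [div_mul_cancel₀ _ (by positivity)] at this
    have h3 : ⟪y, N⟫ / ‖N‖ ≤ ⟪y, N⟫ := div_le_self h2 hN1'
    rw [hy] at h1
    by_contra! h4
    nlinarith
  refine ht ⟨‖N‖⁻¹ • N, ?_, fun y hy => ⟨fun hyc => ?_, fun hyc => ?_⟩⟩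
  · rw [norm_smul, norm_inv, norm_norm, inv_mul_cancel₀ (by positivity)]
  · refine hpos ⟨by rw [mem_closedBall, dist_eq_norm, add_sub_cancel_left, hy]; exact hts, ?_⟩
    rw [Set.mem_ofPred_eq, add_sub_cancel_left, one_smul]
    exact hcap y hy hyc
  · refine hneg ⟨by rw [mem_closedBall, dist_eq_norm, add_sub_cancel_left, hy]; exact hts, ?_⟩
    have := hcap (-y) (by rwa [norm_neg]) (mem_coneNeg_iff.1 hyc)
    rwa [Set.mem_ofPred_eq, add_sub_cancel_left, neg_one_smul, inner_neg_right, ← inner_neg_left]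

/-- Below any scale at which the surface fails to be split around `x` there is a fat tetrahedron
with one vertex at `x`. -/
lemma exists_fat_tetrahedron {U : Set E3} (hU : IsOpen U) {x v : E3} (hv : ‖v‖ = 1) {δ : ℝ}
    (hδ : 0 < δ)
    (hpos : ∀ y ∈ closedBall x δ, y - x ∈ conePos (Real.pi / 4) v → y ∈ U ∪ {x})
    (hneg : ∀ y ∈ closedBall x δ, y - x ∈ coneNeg (Real.pi / 4) v → y ∈ (closure U)ᶜ ∪ {x})
    {t : ℝ} (ht0 : 0 < t) (ht : ¬ SphereSplit U x t) :
    ∃ s, 0 < s ∧ s ≤ t ∧ ∃ u v w : E3,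
      x + u ∈ frontier U ∧ x + v ∈ frontier U ∧ x + w ∈ frontier U ∧
      ‖u‖ ≤ 2 * s ∧ ‖v‖ ≤ 2 * s ∧ ‖w‖ ≤ 2 * s ∧ s ^ 2 / 2 ≤ ‖u‖ ^ 2 ∧
      s ^ 3 / 4 < |tripleDet u v w| := by
  have hsmall : ∀ r, 0 < r → r ≤ δ → SphereSplit U x r := by
    intro r hr hrδ
    refine ⟨v, hv, fun y hy => ?_⟩
    have hy0 : y ≠ 0 := by rintro rfl; simp at hy; linarith
    have hb : x + y ∈ closedBall x δ := by simp [hy, hrδ]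
    have hne : x + y ∉ ({x} : Set E3) := by simpa using hy0
    exact ⟨fun hc => (hpos _ hb (by simpa using hc)).resolve_right hne,
      fun hc => (hneg _ hb (by simpa using hc)).resolve_right hne⟩
  set B := {r : ℝ | 0 < r ∧ ¬ SphereSplit U x r} with hB
  have hbdd : BddBelow B := ⟨0, fun r hr => hr.1.le⟩
  have hδB : ∀ r ∈ B, δ ≤ r := by
    intro r hr
    by_contra! h
    exact hr.2 (hsmall r hr.1 h.le)
  have hd : δ ≤ sInf B := le_csInf ⟨t, ht0, ht⟩ hδB
  have hdt : sInf B ≤ t := csInf_le hbdd ⟨ht0, ht⟩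
  -- The infimum of the bad radii need not be bad: `2/3` of it is a split radius, and a bad `r`
  -- below `4/3` of it is at most twice that.
  obtain ⟨r, hrB, hr⟩ := exists_lt_of_csInf_lt (⟨t, ht0, ht⟩ : B.Nonempty)
    (show sInf B < 4 / 3 * sInf B by linarith)
  have hdr : sInf B ≤ r := csInf_le hbdd hrB
  have hsplit : SphereSplit U x (2 / 3 * sInf B) := by
    by_contra h
    have := csInf_le hbdd (show 2 / 3 * sInf B ∈ B from ⟨by linarith, h⟩)
    linarith
  exact ⟨2 / 3 * sInf B, by linarith, by linarith, exists_tripleDet_gt hU (by linarith) hsplit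
    (by linarith) (by linarith) hrB.2⟩

/-! ### Stability of volume and lower bounds for the curvature -/

lemma abs_coord_le_norm (u : E3) (i : Fin 3) : |u i| ≤ ‖u‖ := by
  simpa using PiLp.norm_apply_le u i

lemma abs_tripleDet_le (u v w : E3) : |tripleDet u v w| ≤ 6 * (‖u‖ * ‖v‖ * ‖w‖) := by
  have key : ∀ i j k, |u i * v j * w k| ≤ ‖u‖ * ‖v‖ * ‖w‖ := by
    intro i j k
    rw [abs_mul, abs_mul]
    gcongr <;> exact abs_coord_le_norm _ _
  rw [tripleDet_eq]
  have h1 := abs_le.1 (key 0 1 2)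
  have h2 := abs_le.1 (key 0 2 1)
  have h3 := abs_le.1 (key 1 0 2)
  have h4 := abs_le.1 (key 1 2 0)
  have h5 := abs_le.1 (key 2 0 1)
  have h6 := abs_le.1 (key 2 1 0)
  rw [abs_le]
  constructor <;> linarith [h1.1, h1.2, h2.1, h2.2, h3.1, h3.2, h4.1, h4.2, h5.1, h5.2, h6.1, h6.2]

/-- Multilinearity: the arguments are changed one at a time, each change costing at most `6 M² η`.
-/
lemma abs_tripleDet_sub_le {u v w u' v' w' : E3} {M η : ℝ} (hv : ‖v‖ ≤ M) (hw : ‖w‖ ≤ M)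
    (hu' : ‖u'‖ ≤ M) (hv' : ‖v'‖ ≤ M)
    (hdu : ‖u' - u‖ ≤ η) (hdv : ‖v' - v‖ ≤ η) (hdw : ‖w' - w‖ ≤ η) :
    |tripleDet u' v' w' - tripleDet u v w| ≤ 18 * (M ^ 2 * η) := by
  have hM : 0 ≤ M := (norm_nonneg _).trans hv
  have hη : 0 ≤ η := (norm_nonneg _).trans hdu
  have hsplit : tripleDet u' v' w' - tripleDet u v w =
      tripleDet (u' - u) v w + tripleDet u' (v' - v) w + tripleDet u' v' (w' - w) := by
    simp only [tripleDet_eq, PiLp.sub_apply]; ring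
  have h1 : |tripleDet (u' - u) v w| ≤ 6 * (η * M * M) :=
    (abs_tripleDet_le _ _ _).trans (by gcongr)
  have h2 : |tripleDet u' (v' - v) w| ≤ 6 * (M * η * M) :=
    (abs_tripleDet_le _ _ _).trans (by gcongr)
  have h3 : |tripleDet u' v' (w' - w)| ≤ 6 * (M * M * η) :=
    (abs_tripleDet_le _ _ _).trans (by gcongr)
  rw [hsplit]
  refine (abs_add_three _ _ _).trans ?_
  nlinarith

lemma tripleDet_eq_zero_of_coplanar {a b c d : E3} (h : Coplanar ℝ ({a, b, c, d} : Set E3)) :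
    tripleDet (b - a) (c - a) (d - a) = 0 := by
  by_contra hne
  have hli : LinearIndependent ℝ ![b - a, c - a, d - a] := by
    have h1 : LinearIndependent ℝ (!![(b - a) 0, (b - a) 1, (b - a) 2;
        (c - a) 0, (c - a) 1, (c - a) 2; (d - a) 0, (d - a) 1, (d - a) 2]).row :=
      Matrix.linearIndependent_rows_of_det_ne_zero hne
    refine LinearIndependent.of_comp (WithLp.linearEquiv 2 ℝ (Fin 3 → ℝ)).toLinearMap ?_
    convert h1 using 1
    · ext i j
      fin_cases i <;> fin_cases j <;> rfl
    · rfl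
  have hspan : Submodule.span ℝ (Set.range ![b - a, c - a, d - a]) ≤
      vectorSpan ℝ ({a, b, c, d} : Set E3) := by
    rw [Submodule.span_le]
    rintro _ ⟨i, rfl⟩
    fin_cases i
    · exact vsub_mem_vectorSpan ℝ (p₁ := b) (p₂ := a) (by simp) (by simp)
    · exact vsub_mem_vectorSpan ℝ (p₁ := c) (p₂ := a) (by simp) (by simp)
    · exact vsub_mem_vectorSpan ℝ (p₁ := d) (p₂ := a) (by simp) (by simp)
  have h3 := finrank_span_eq_card hli
  have h4 := Submodule.finrank_mono hspan
  have h5 := coplanar_iff_finrank_le_two.1 h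
  simp at h3
  omega

/-- Cauchy–Schwarz for `(u × v) · w` with Lagrange's identity for `|u × v|²`; it makes a face of a
nondegenerate tetrahedron have positive area. -/
lemma tripleDet_sq_le (u v w : E3) :
    tripleDet u v w ^ 2 ≤ (‖u‖ ^ 2 * ‖v‖ ^ 2 - ⟪u, v⟫ ^ 2) * ‖w‖ ^ 2 := by
  simp only [EuclideanSpace.norm_sq_eq, Real.norm_eq_abs, sq_abs, Fin.sum_univ_three,
    PiLp.inner_apply, tripleDet_eq, RCLike.inner_apply, conj_trivial]
  nlinarith [sq_nonneg ((u 1 * v 2 - u 2 * v 1) * w 1 - (u 2 * v 0 - u 0 * v 2) * w 0),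
    sq_nonneg ((u 1 * v 2 - u 2 * v 1) * w 2 - (u 0 * v 1 - u 1 * v 0) * w 0),
    sq_nonneg ((u 2 * v 0 - u 0 * v 2) * w 2 - (u 0 * v 1 - u 1 * v 0) * w 1)]

lemma triangleArea_nonneg (a b c : E3) : 0 ≤ triangleArea a b c := by
  unfold triangleArea; positivity

lemma triangleArea_le (a b c : E3) : triangleArea a b c ≤ ‖b - a‖ * ‖c - a‖ / 2 := by
  unfold triangleArea
  gcongr
  rw [Real.sqrt_le_left (by positivity)]
  nlinarith [sq_nonneg (⟪b - a, c - a⟫ : ℝ)]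

/-- A tetrahedron of size at most `3 s` and volume at least `s³ / 48` is strongly curved. -/
lemma le_curvK {a b c d : E3} {s : ℝ} (hs : 0 < s) (hb : ‖b - a‖ ≤ 3 * s) (hc : ‖c - a‖ ≤ 3 * s)
    (hd : ‖d - a‖ ≤ 3 * s) (hdet : s ^ 3 / 8 ≤ |tripleDet (b - a) (c - a) (d - a)|) :
    1 / 130000 / s ≤ curvK a b c d := by
  have hpos : 0 < |tripleDet (b - a) (c - a) (d - a)| := lt_of_lt_of_le (by positivity) hdet
  have hne : tripleDet (b - a) (c - a) (d - a) ≠ 0 := abs_pos.1 hpos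
  rw [curvK, if_neg (fun h => hne (tripleDet_eq_zero_of_coplanar h))]
  have hV : s ^ 3 / 48 ≤ tetraVolume a b c d := by
    change _ ≤ |tripleDet (b - a) (c - a) (d - a)| / 6
    linarith
  have hV0 : 0 ≤ tetraVolume a b c d := le_trans (by positivity) hV
  have hA0 : 0 < triangleArea a b c := by
    have h1 := tripleDet_sq_le (b - a) (c - a) (d - a)
    have h2 : 0 < tripleDet (b - a) (c - a) (d - a) ^ 2 := by positivity
    have h3 := pos_of_mul_pos_left (h2.trans_le h1) (sq_nonneg _)
    unfold triangleArea
    positivity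
  have hA : 0 < tetraArea a b c d := by
    have := triangleArea_nonneg a b d
    have := triangleArea_nonneg a c d
    have := triangleArea_nonneg b c d
    unfold tetraArea
    linarith
  have hcb : ‖c - b‖ ≤ 6 * s := by
    have := norm_sub_le (c - a) (b - a)
    rw [sub_sub_sub_cancel_right] at this; linarith
  have hdb : ‖d - b‖ ≤ 6 * s := by
    have := norm_sub_le (d - a) (b - a)
    rw [sub_sub_sub_cancel_right] at this; linarith
  have hdc : ‖d - c‖ ≤ 6 * s := by
    have := norm_sub_le (d - a) (c - a)
    rw [sub_sub_sub_cancel_right] at this; linarith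
  have htri : ∀ {x y z : E3} {p q : ℝ}, ‖y - x‖ ≤ p → ‖z - x‖ ≤ q →
      triangleArea x y z ≤ p * q / 2 := fun {x y z p q} hp hq =>
    (triangleArea_le x y z).trans (by
      have := (norm_nonneg _).trans hp
      gcongr)
  have hA' : tetraArea a b c d ≤ 36 * s ^ 2 := by
    have h1 := htri hb hc
    have h2 := htri hb hd
    have h3 := htri hc hd
    have h4 := htri hcb hdb
    unfold tetraArea
    nlinarith
  have hfin : Bornology.IsBounded ({a, b, c, d} : Set E3) := (Set.toFinite _).isBounded
  have hdiam0 : 0 < diam ({a, b, c, d} : Set E3) := by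
    have hab : b ≠ a := by
      rintro rfl
      exact hne (by simp [tripleDet_eq])
    exact (dist_pos.2 hab).trans_le (dist_le_diam_of_mem hfin (by simp) (by simp))
  have hdiam : diam ({a, b, c, d} : Set E3) ≤ 6 * s := by
    have hsub : ({a, b, c, d} : Set E3) ⊆ closedBall a (3 * s) := by
      intro y hy
      simp only [Set.mem_insert_iff, Set.mem_singleton_iff] at hy
      rw [mem_closedBall, dist_eq_norm]
      rcases hy with rfl | rfl | rfl | rfl
      · simpa using hs.le
      all_goals assumption
    calc _ ≤ diam (closedBall a (3 * s)) := diam_mono hsub isBounded_closedBall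
      _ ≤ 2 * (3 * s) := diam_closedBall (by positivity)
      _ = 6 * s := by ring
  -- Here `48 · 36 · 36 = 62208`, so the constant has room to spare.
  calc 1 / 130000 / s ≤ (s ^ 3 / 48) / (36 * s ^ 2 * (6 * s) ^ 2) := by
        rw [div_le_div_iff₀ hs (by positivity)]
        nlinarith [pow_pos hs 4]
    _ ≤ _ := by gcongr

/-! ### Energy estimates and the resulting bound on the scale -/

/-- Integrating the curvature over four small balls around the vertices of a fat tetrahedron. -/
lemma le_mengerEnergy {S : Set E3} {p k : ℝ} {m : ENNReal} (hp : 0 ≤ p) (hk : 0 ≤ k)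
    {A₀ A₁ A₂ A₃ : Set E3} (h₀ : MeasurableSet A₀) (h₁ : MeasurableSet A₁)
    (h₂ : MeasurableSet A₂) (h₃ : MeasurableSet A₃)
    (hm₀ : m ≤ H2 (S ∩ A₀)) (hm₁ : m ≤ H2 (S ∩ A₁)) (hm₂ : m ≤ H2 (S ∩ A₂))
    (hm₃ : m ≤ H2 (S ∩ A₃))
    (hK : ∀ a ∈ A₀, ∀ b ∈ A₁, ∀ c ∈ A₂, ∀ d ∈ A₃, k ≤ curvK a b c d) :
    ENNReal.ofReal (k ^ p) * m ^ 4 ≤ mengerEnergy p S := by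
  -- Peels off one integral; only `A` has to be measurable, not the integrand.
  have step : ∀ {A : Set E3} {f : E3 → ENNReal} {q : ENNReal}, MeasurableSet A →
      m ≤ H2 (S ∩ A) → (∀ y ∈ A, q ≤ f y) → q * m ≤ ∫⁻ y in S, f y ∂H2 := by
    intro A f q hA hm hf
    calc q * m ≤ q * H2.restrict S A := by
          rw [Measure.restrict_apply hA, Set.inter_comm]; gcongr
      _ = ∫⁻ _ in A, q ∂(H2.restrict S) := (setLIntegral_const _ _).symm
      _ ≤ ∫⁻ y in A, f y ∂(H2.restrict S) := setLIntegral_mono' hA hf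
      _ ≤ ∫⁻ y in S, f y ∂H2 := setLIntegral_le_lintegral _ _
  have : ENNReal.ofReal (k ^ p) * m ^ 4 = ENNReal.ofReal (k ^ p) * m * m * m * m := by ring
  rw [this]
  refine step h₀ hm₀ fun a ha => step h₁ hm₁ fun b hb => step h₂ hm₂ fun c hc =>
    step h₃ hm₃ fun d hd => ?_
  exact ENNReal.ofReal_le_ofReal (Real.rpow_le_rpow hk (hK a ha b hb c hc d hd) hp)

/-- A fat tetrahedron of size `s`, together with a lower area bound at scale `s / 3000`, bounds
the integral Menger curvature from below. -/
lemma le_mengerEnergy_of_tripleDet {S : Set E3} {x u v w : E3} {s κ p : ℝ} (hs : 0 < s)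
    (hκ : 0 ≤ κ) (hp : 0 ≤ p) (hx : x ∈ S) (hu : x + u ∈ S) (hv : x + v ∈ S) (hw : x + w ∈ S)
    (hun : ‖u‖ ≤ 2 * s) (hvn : ‖v‖ ≤ 2 * s) (hwn : ‖w‖ ≤ 2 * s)
    (hdet : s ^ 3 / 4 < |tripleDet u v w|)
    (hS : ∀ y ∈ S, ENNReal.ofReal (κ * s ^ 2) ≤ H2 (S ∩ closedBall y (s / 3000))) :
    ENNReal.ofReal ((1 / 130000 / s) ^ p * (κ * s ^ 2) ^ 4) ≤ mengerEnergy p S := by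
  rw [ENNReal.ofReal_mul (by positivity), ENNReal.ofReal_pow (by positivity)]
  refine le_mengerEnergy hp (by positivity) measurableSet_closedBall measurableSet_closedBall
    measurableSet_closedBall measurableSet_closedBall (hS _ hx) (hS _ hu) (hS _ hv) (hS _ hw) ?_
  intro a ha b hb c hc d hd
  have hdiff : ∀ {q z : E3}, q ∈ closedBall (x + z) (s / 3000) → ‖(q - a) - z‖ ≤ s / 1500 := by
    intro q z hq
    rw [mem_closedBall, dist_eq_norm] at hq ha
    have : (q - a) - z = (q - (x + z)) - (a - x) := by abel
    rw [this]
    exact (norm_sub_le _ _).trans (by linarith)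
  have hnorm : ∀ {q z : E3}, q ∈ closedBall (x + z) (s / 3000) → ‖z‖ ≤ 2 * s →
      ‖q - a‖ ≤ 3 * s := by
    intro q z hq hz
    have := norm_le_norm_add_norm_sub' (q - a) z
    linarith [hdiff hq]
  refine le_curvK hs (hnorm hb hun) (hnorm hc hvn) (hnorm hd hwn) ?_
  have h1 := abs_tripleDet_sub_le (hvn.trans (by linarith : _ ≤ 3 * s)) (hwn.trans (by linarith))
    (hnorm hb hun) (hnorm hc hvn) (hdiff hb) (hdiff hc) (hdiff hd)
  have h2 := abs_sub_abs_le_abs_sub (tripleDet u v w) (tripleDet (b - a) (c - a) (d - a))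
  rw [abs_sub_comm] at h2
  -- Moving the vertices by `s / 3000` changes the determinant by at most `0.108 s³`, less than half
  -- of `s³ / 4`.
  have h3 : 18 * ((3 * s) ^ 2 * (s / 1500)) ≤ s ^ 3 / 8 := by nlinarith [pow_pos hs 3]
  linarith

lemma le_rpow_of_energy_le {c κ s p E : ℝ} (hc : 0 < c) (hs : 0 < s) (hE : 0 < E)
    (h : (c / s) ^ p * (κ * s ^ 2) ^ 4 ≤ E) : c ^ p * κ ^ 4 / E ≤ s ^ (p - 8) := by
  have h8 : s ^ (p - 8) * s ^ 8 = s ^ p := by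
    rw [← Real.rpow_natCast s 8, ← Real.rpow_add hs]; norm_num
  have hsp : 0 < s ^ p := Real.rpow_pos_of_pos hs p
  rw [Real.div_rpow hc.le hs.le, div_mul_eq_mul_div, div_le_iff₀ hsp, ← h8] at h
  rw [div_le_iff₀ hE]
  have h9 : 0 < s ^ 8 := by positivity
  refine le_of_mul_le_mul_right ?_ h9
  nlinarith

/-- The fifth root turns the exponent `5 * p` into `p`. Then `κ ≤ 1` gives `κ ^ p ≤ κ ^ 4`, and the
factor `1/4` in the base yields `s / 4`. -/
lemma radius0_le {c κ s p E : ℝ} (hc : 0 < c) (hκ : 0 < κ) (hκ1 : κ ≤ 1) (hs : 0 < s)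
    (hp : 8 < p) (hE : 0 < E) (h : c ^ p * κ ^ 4 / E ≤ s ^ (p - 8)) :
    radius0 ((c * κ / 4) ^ (1 / 5 : ℝ)) E p ≤ s / 4 := by
  have hp8 : 0 < p - 8 := by linarith
  have h1 : ((c * κ / 4) ^ (1 / 5 : ℝ)) ^ (5 * p) = (c * κ / 4) ^ p := by
    rw [← Real.rpow_mul (by positivity)]; congr 1; ring
  have h2 : (c * κ / 4) ^ p ≤ c ^ p * κ ^ 4 * (1 / 4) ^ (p - 8) := by
    have h3 : κ ^ p ≤ κ ^ 4 := by
      rw [← Real.rpow_natCast κ 4]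
      exact Real.rpow_le_rpow_of_exponent_ge hκ hκ1 (by norm_num; linarith)
    have h4 : (1 / 4 : ℝ) ^ p ≤ (1 / 4) ^ (p - 8) :=
      Real.rpow_le_rpow_of_exponent_ge (by norm_num) (by norm_num) (by linarith)
    rw [div_eq_mul_one_div, Real.mul_rpow (by positivity) (by norm_num),
      Real.mul_rpow hc.le hκ.le]
    gcongr
  have h5 : (c * κ / 4) ^ p / E ≤ (s / 4) ^ (p - 8) := by
    rw [div_eq_mul_one_div s, Real.mul_rpow hs.le (by norm_num)]
    calc (c * κ / 4) ^ p / E ≤ c ^ p * κ ^ 4 * (1 / 4) ^ (p - 8) / E := by gcongr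
      _ = c ^ p * κ ^ 4 / E * (1 / 4) ^ (p - 8) := by ring
      _ ≤ _ := by gcongr
  rw [radius0, h1, one_div (p - 8)]
  exact (Real.rpow_inv_le_iff_of_pos (by positivity) (by positivity) hp8).2 h5

/-- Area bounds pass from a dense set of centres to all points of the surface. -/
lemma le_H2_of_dense {S D : Set E3} (hDS : S ⊆ closure D) {R : ℝ} (hR : 0 < R)
    (h : ∀ x ∈ D, ∀ r, 0 < r → r < R →
      ENNReal.ofReal (Real.pi * r ^ 2 / 2) ≤ H2 (S ∩ closedBall x r))
    {x : E3} (hx : x ∈ S) :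
    ENNReal.ofReal (Real.pi * R ^ 2 / 2) ≤ H2 (S ∩ closedBall x R) := by
  have hcont : Filter.Tendsto (fun r : ℝ => ENNReal.ofReal (Real.pi * r ^ 2 / 2))
      (nhdsWithin R (Set.Iio R)) (nhds (ENNReal.ofReal (Real.pi * R ^ 2 / 2))) :=
    ((ENNReal.continuous_ofReal.comp (by fun_prop :
      Continuous fun r : ℝ => Real.pi * r ^ 2 / 2)).tendsto R).mono_left nhdsWithin_le_nhds
  refine le_of_tendsto hcont ?_
  filter_upwards [Ioo_mem_nhdsLT hR] with r hr
  -- The ball of radius `r < R` about such a `y` lies in the ball of radius `R` about `x`; then `r`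
  -- tends to `R`.
  obtain ⟨y, hyD, hy⟩ := Metric.mem_closure_iff.1 (hDS hx) (R - r) (by linarith [hr.2])
  refine (h y hyD r hr.1 hr.2).trans (measure_mono (Set.inter_subset_inter_right _ ?_))
  apply closedBall_subset_closedBall'
  rw [dist_comm]; linarith

end MengerSurface

end

/-! ### The theorem: maximal uniform splitting radius -/

open MengerSurface in
theorem theorem3p1 :
    ∃ α : ℝ, 0 < α ∧ ∀ p : ℝ, 8 < p → ∀ E : ℝ, 0 < E →
      ∀ S : Set MengerSurface.E3, MengerSurface.Admissible S →
        MengerSurface.mengerEnergy p S ≤ ENNReal.ofReal E →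
        MengerSurface.radius0 α E p ≤ Metric.diam S ∧
        ∀ x ∈ S, ∀ R : ℝ, 0 < R → R ≤ MengerSurface.radius0 α E p →
          ENNReal.ofReal (Real.pi * R ^ 2 / 2) ≤
            MengerSurface.H2 (S ∩ Metric.closedBall x R) := by
  -- Any value up to `π / 2 / 3000 ^ 2`, the area bound at radius `s / 3000`, would serve; this one
  -- is also visibly at most 1.
  obtain ⟨κ, hκ⟩ : ∃ κ : ℝ, κ = Real.pi / 8 / 3000 ^ 2 := ⟨_, rfl⟩
  have hκ0 : 0 < κ := by rw [hκ]; positivity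
  have hκ1 : κ ≤ 1 := by rw [hκ]; linarith [Real.pi_le_four]
  refine ⟨((1 / 130000) * κ / 4) ^ (1 / 5 : ℝ), by positivity, ?_⟩
  rintro p hp E hE S ⟨hcpt, hconn, U, hU, -, -, rfl, ⟨K, hK, hreg⟩, D, hDS, hSD, hcone⟩ hM
  have hp8 : 0 < p - 8 := by linarith
  -- A scale without splitting produces a fat tetrahedron of at most that scale.
  have hfat : ∀ x ∈ D, ∀ t, 0 < t → ¬ SphereSplit U x t →
      ∃ s, 0 < s ∧ s ≤ t ∧ s / 2 ≤ diam (frontier U) ∧ ∀ κ' : ℝ, 0 ≤ κ' →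
        (∀ y ∈ frontier U,
          ENNReal.ofReal (κ' * s ^ 2) ≤ H2 (frontier U ∩ closedBall y (s / 3000))) →
        (1 / 130000) ^ p * κ' ^ 4 / E ≤ s ^ (p - 8) := by
    intro x hx t ht hns
    obtain ⟨v₀, hv₀, δ, hδ, hpos, hneg⟩ := hcone x hx
    obtain ⟨s, hs, hst, u, v, w, hu, hv, hw, hun, hvn, hwn, hul, hdet⟩ :=
      exists_fat_tetrahedron hU hv₀ hδ hpos hneg ht hns
    refine ⟨s, hs, hst, ?_, fun κ' hκ' hS => ?_⟩
    · have h1 : ‖u‖ ≤ diam (frontier U) := by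
        simpa [dist_eq_norm] using dist_le_diam_of_mem hcpt.isBounded hu (hDS hx)
      nlinarith [norm_nonneg u]
    · refine le_rpow_of_energy_le (by norm_num) hs hE ?_
      have := (le_mengerEnergy_of_tripleDet hs hκ' (by linarith) (hDS hx) hu hv hw hun hvn hwn
        hdet hS).trans hM
      exact (ENNReal.ofReal_le_ofReal_iff hE.le).1 this
  set A := {r : ℝ | 0 < r ∧ ∀ x ∈ D, ∀ t, 0 < t → t < r → SphereSplit U x t} with hA
  -- The only use of the surface-dependent `K`, whose size leaves no trace in the final constant.
  have hAne : A.Nonempty := by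
    have hq : 0 < (1 / 130000 : ℝ) ^ p * (K⁻¹ / 3000 ^ 2) ^ 4 / E := by positivity
    refine ⟨((1 / 130000 : ℝ) ^ p * (K⁻¹ / 3000 ^ 2) ^ 4 / E) ^ (p - 8)⁻¹, by positivity, ?_⟩
    intro x hx t ht htr
    by_contra hns
    obtain ⟨s, hs, hst, hdiam, hest⟩ := hfat x hx t ht hns
    have h1 := hest (K⁻¹ / 3000 ^ 2) (by positivity) fun y hy => by
      convert (hreg y hy (s / 3000) (by positivity) (by linarith)).2 using 2
      ring
    have h2 := (Real.rpow_inv_le_iff_of_pos hq.le hs.le hp8).2 h1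
    linarith
  obtain ⟨z, hz⟩ := hconn.nonempty
  obtain ⟨x₀, hx₀, -⟩ := Metric.mem_closure_iff.1 (hSD hz) 1 one_pos
  have hAlt : ∀ r ∈ A, ∀ x ∈ D, ∀ t, 0 < t → ¬ SphereSplit U x t → r ≤ t := by
    intro r hr x hx t ht hns
    by_contra! h
    exact hns (hr.2 x hx t ht h)
  have hbdd : BddAbove A := by
    obtain ⟨M, hM0, hMb⟩ := hcpt.isBounded.subset_closedBall_lt 0 x₀
    refine ⟨2 * M, fun r hr => hAlt r hr x₀ hx₀ (2 * M) (by positivity) ?_⟩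
    rintro ⟨v, hv, h⟩
    obtain ⟨b, rfl⟩ := exists_orthonormalBasis_two_eq hv
    -- A split sphere of radius `2 * M` would force a surface point at distance at least `5 / 4 * M`
    -- from `x₀`; the offset is allowed since `(5/4)² ≤ 2`.
    obtain ⟨t, -, ht⟩ := exists_mem_frontier_of_split b hU (by positivity) h (5 / 4 * M) 0
      (by nlinarith)
    have h1 := hMb ht
    rw [mem_closedBall, dist_eq_norm, add_sub_cancel_left] at h1
    have h2 := norm_sq_ofCoord b (5 / 4 * M) 0 t
    nlinarith [norm_nonneg (ofCoord b (5 / 4 * M) 0 t)]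
  obtain ⟨r₀, hr₀⟩ := hAne
  have hd0 : 0 < sSup A := hr₀.1.trans_le (le_csSup hbdd hr₀)
  have hsplit : ∀ x ∈ D, ∀ t, 0 < t → t < sSup A → SphereSplit U x t := by
    intro x hx t ht htd
    obtain ⟨r, hr, htr⟩ := exists_lt_of_lt_csSup ⟨r₀, hr₀⟩ htd
    exact hr.2 x hx t ht htr
  have harea : ∀ R, 0 < R → R < sSup A → ∀ x ∈ frontier U,
      ENNReal.ofReal (Real.pi * R ^ 2 / 2) ≤ H2 (frontier U ∩ closedBall x R) :=
    fun R hR hRd x hx => le_H2_of_dense hSD hR (fun y hy r hr hrR =>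
      (hsplit y hy r hr (hrR.trans hRd)).le_H2 hU hr) hx
  have hnot : ¬ (2 * sSup A ∈ A) := fun h => by
    have := le_csSup hbdd h
    linarith
  obtain ⟨x, hx, t, ht, htd, hns⟩ : ∃ x ∈ D, ∃ t, 0 < t ∧ t < 2 * sSup A ∧
      ¬ SphereSplit U x t := by
    by_contra! h
    exact hnot ⟨by positivity, h⟩
  obtain ⟨s, hs, hst, hdiam, hest⟩ := hfat x hx t ht hns
  -- Now `s / 3000` lies below `sSup A`, so splitting supplies the area bound with the absolute `κ`.
  have h1 := hest κ hκ0.le fun y hy => by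
    refine le_trans (ENNReal.ofReal_le_ofReal ?_)
      (harea (s / 3000) (by positivity) (by linarith) y hy)
    rw [hκ]
    nlinarith [mul_pos Real.pi_pos (pow_pos hs 2)]
  have h2 := radius0_le (by norm_num : (0 : ℝ) < 1 / 130000) hκ0 hκ1 hs hp hE h1
  exact ⟨by linarith, fun y hy R hR hRr => harea R hR (by linarith) y hy⟩
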